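/- Let $G$ be a Hausdorff topological group acting continuously on a compact Hausdorff space $X$. Assume that $(G,X)$ is minimal (every $G$-orbit is dense) and distal (if $x,y\in X$ are proximal, i.e. for every neighbourhood $U$ of the diagonal of $X\times X$ there is $g\in G$ with $(gx,gy)\in U$, then $x=y$). Let $d\ge 1$. Let $X^{[d]}=X^{\{0,1\}^d}$ with the product topology, and for $x\in X$ let $x^{[d]}\in X^{[d]}$ be the constant configuration with all entries $x$. The group $G^{[d]}=G^{\{0,1\}^d}$ acts coordinatewise on $X^{[d]}$. For $g\in G$ and $F\subset\{0,1\}^d$ let $[g]_F\in G^{[d]}$ be $g$ on $F$ and the identity elsewhere. Let $\mathcal{HK}^{[d]}\le G^{[d]}$ be the subgroup generated by all $[g]_F$ with $g\in G$ and $F=\{\omega:\omega_i=a\}$, $1\le i\le d$, $a\in\{0,1\}$ (hyperfaces), and $\mathcal F^{[d]}$ the subgroup generated by all $[g]_F$ with $g\in G$ and $F=\{\omega:\omega_i=1\}$, $1\le i\le d$ (upper hyperfaces). Put $$C_G^{[d]}(X)=\overline{\{\gamma x^{[d]}:\gamma\in\mathcal{HK}^{[d]},\,x\in X\}},\qquad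 C_x^{[d]}(X)=\{c\in C_G^{[d]}(X): c(\vec 0)=x\},\qquad Y_x^{[d]}(X)=\overline{\mathcal F^{[d]}x^{[d]}},$$ and let $C_{x*}^{[d]}(X)$ and $Y_{x*}^{[d]}(X)$ be the images of $C_x^{[d]}(X)$ and $Y_x^{[d]}(X)$ under the projection $\pi_*:X^{\{0,1\}^d}\to X^{\{0,1\}^d\setminus\{\vec 0\}}$ that forgets the $\vec 0$-coordinate. Then for every $x\in X$ $$Y_x^{[d]}(X)=C_x^{[d]}(X),\qquad\text{and hence}\qquad Y_{x*}^{[d]}(X)=C_{x*}^{[d]}(X).$$ -/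

import Mathlib

open Topology

namespace CubeDynamics

section Combinatorics

/-- The discrete cube `{0,1}^d`; its vertex `0` is the zero vector. -/
abbrev Cube (d : ℕ) : Type := Fin d → Fin 2

/-- The set `X^[d]` of `d`-configurations, i.e. maps `{0,1}^d → X`. For a group `G`, the group
`G^[d]` (pointwise multiplication) acts coordinatewise on `X^[d]`; for a topological space `X`,
`X^[d]` carries the product topology. -/
abbrev Config (d : ℕ) (X : Type*) : Type _ := Cube d → X

/-- The constant configuration `x^[d]`. -/
def constConfig {X : Type*} (d : ℕ) (x : X) : Config d X := fun _ => x

/-- The hyperface `{ω | ω i = a}` of the discrete cube. -/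
def hyperface {d : ℕ} (i : Fin d) (a : Fin 2) : Set (Cube d) := {ω | ω i = a}

/-- The set `X_*^[d]` of configurations on `{0,1}^d ∖ {0}`. -/
abbrev PuncturedConfig (d : ℕ) (X : Type*) : Type _ := {ω : Cube d // ω ≠ 0} → X

/-- The projection `π_* : X^[d] → X_*^[d]` which forgets the `0`-coordinate. -/
def forgetZero {X : Type*} {d : ℕ} (c : Config d X) : PuncturedConfig d X := fun ω => c ω.1

open Classical in
/-- The element `[g]_F` of `G^[d]`: it is `g` on `F` and the identity off `F`. -/
noncomputable def faceElement {G : Type*} [Group G] {d : ℕ} (g : G) (F : Set (Cube d)) :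
    Config d G := fun ω => if ω ∈ F then g else 1

/-- The Host-Kra cube group `HK^[d]`, generated by all `[g]_F`, `F` a hyperface. -/
def hostKraGroup (G : Type*) [Group G] (d : ℕ) : Subgroup (Config d G) :=
  Subgroup.closure {γ | ∃ (g : G) (i : Fin d) (a : Fin 2), γ = faceElement g (hyperface i a)}

/-- The face cube group `F^[d]`, generated by all `[g]_F`, `F` an upper hyperface. -/
def faceGroup (G : Type*) [Group G] (d : ℕ) : Subgroup (Config d G) :=
  Subgroup.closure {γ | ∃ (g : G) (i : Fin d), γ = faceElement g (hyperface i 1)}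

end Combinatorics

section Dynamics

variable (G : Type*) [Group G] {X : Type*} [TopologicalSpace X] [MulAction G X]

/-- `x` and `y` are proximal: the pairs `(g x, g y)` enter every neighbourhood of the diagonal.
(On a compact Hausdorff space the neighbourhoods of the diagonal are the entourages of the unique
compatible uniformity, so this says that some net `g_i` brings `g_i x`, `g_i y` together.) -/
def Proximal (x y : X) : Prop :=
  ∀ U ∈ 𝓝ˢ (Set.diagonal X), ∃ g : G, (g • x, g • y) ∈ U

/-- `(G, X)` is distal: the proximal relation is the diagonal. -/
def IsDistal (X : Type*) [TopologicalSpace X] [MulAction G X] : Prop :=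
  {p : X × X | Proximal G p.1 p.2} = Set.diagonal X

/-- The dynamical cubes `C_G^[d](X)`: the closure of the set of all `γ x^[d]` with
`γ ∈ HK^[d]` and `x ∈ X`. -/
def dynCubes (X : Type*) [TopologicalSpace X] [MulAction G X] (d : ℕ) : Set (Config d X) :=
  closure (⋃ x : X, MulAction.orbit (hostKraGroup G d) (constConfig d x))

/-- `C_x^[d](X)`: the dynamical cubes whose `0`-vertex is `x`. -/
def cubesAt (d : ℕ) (x : X) : Set (Config d X) := dynCubes G X d ∩ {c | c 0 = x}

/-- `C_{x*}^[d](X)`, the image of `C_x^[d](X)` under `π_*`. -/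
def puncturedCubesAt (d : ℕ) (x : X) : Set (PuncturedConfig d X) := forgetZero '' cubesAt G d x

/-- `Y_x^[d](X)`: the orbit closure of `x^[d]` under the face cube group `F^[d]`. -/
def faceOrbitClosure (d : ℕ) (x : X) : Set (Config d X) :=
  closure (MulAction.orbit (faceGroup G d) (constConfig d x))

/-- `Y_{x*}^[d](X)`, the image of `Y_x^[d](X)` under `π_*`. -/
def puncturedFaceOrbitClosure (d : ℕ) (x : X) : Set (PuncturedConfig d X) :=
  forgetZero '' faceOrbitClosure G d x

end Dynamics

end CubeDynamics

/-!
A distal system on a compact space is a disjoint union of orbit closures: every element of the Ellis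
semigroup has a left multiple that is idempotent, and by distality idempotents act trivially. This
applies to all subgroups of `G^[d]` acting on `X^[d]`.

Write a cube of dimension `d + 1` as a pair `(e, b)` of opposite faces, and let `N` be the group of
all `n` with `(1, n) ∈ F^[d+1]`. For an open neighbourhood `W` of the diagonal of `X^[d] × X^[d]`
call a cube `e` regular if every cube `(e, b)` has `b` within `W` of the orbit `N e`. Cover `X^[d]`
by finitely many open sets that are small with respect to `W`; the cubes whose `N`-orbit meets a
given one of them form an open set, and any cube outside the nowhere dense frontiers of these
finitely many sets is regular. Regularity passes to the `N`-orbit closure, which by minimality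
contains a cube with any prescribed `0`-vertex.

The theorem follows by induction on `d`. If `c ∈ C_x^[d+1]` is not in `Y_x^[d+1]`, then the orbit
closures of `c` and `x^[d+1]` under `F^[d+1]` are disjoint, so some `W` contains no pair `(b, b')`
for which `(e, b)` is in the first and `(e, b')` in the second for a common `e`. Take a regular
`e ∈ C_x^[d]`. By induction `e` and the lower face of `c` lie in the same orbit closure `Y_x^[d]`,
so some `(e, b)` is in the orbit closure of `c`, while `(e, n e) ∈ Y_x^[d+1]` for all `n ∈ N`.
Regularity makes `b` `W`-close to some `n e`, a contradiction.
-/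

namespace CubeDynamics

section OrbitClosures

-- A shortcut: the default instance search for this action can time out.
instance {ι M Z : Type*} [Group M] [MulAction M Z] (Γ : Subgroup (ι → M)) : SMul Γ (ι → Z) :=
  Submonoid.smul Γ.toSubmonoid

instance {ι M Z : Type*} [SMul M Z] [TopologicalSpace Z] [ContinuousConstSMul M Z] :
    ContinuousConstSMul (ι → M) (ι → Z) :=
  ⟨fun γ => continuous_pi fun i => (continuous_apply i).const_smul (γ i)⟩

instance {M Z : Type*} [Group M] [MulAction M Z] [TopologicalSpace Z] [ContinuousConstSMul M Z]
    (Γ : Subgroup M) : ContinuousConstSMul Γ Z :=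
  ⟨fun γ => continuous_const_smul (γ : M)⟩

variable {M Z : Type*} [Monoid M] [TopologicalSpace Z] [MulAction M Z]

theorem closure_orbit_subset {S : Set Z} (hS : IsClosed S) (hinv : ∀ (m : M), ∀ z ∈ S, m • z ∈ S)
    {a : Z} (ha : a ∈ S) : closure (MulAction.orbit M a) ⊆ S :=
  closure_minimal (Set.range_subset_iff.mpr fun m => hinv m a ha) hS

theorem smul_mem_closure_orbit [ContinuousConstSMul M Z] (m : M) {a b : Z}
    (hb : b ∈ closure (MulAction.orbit M a)) : m • b ∈ closure (MulAction.orbit M a) :=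
  smul_closure_orbit_subset m a (Set.smul_mem_smul_set hb)

theorem mem_closure_orbit_trans [ContinuousConstSMul M Z] {a b c : Z}
    (hc : c ∈ closure (MulAction.orbit M b)) (hb : b ∈ closure (MulAction.orbit M a)) :
    c ∈ closure (MulAction.orbit M a) :=
  closure_orbit_subset isClosed_closure (fun m _ => smul_mem_closure_orbit m) hb hc

end OrbitClosures

section EllisSemigroup

variable {Z : Type*} [TopologicalSpace Z]

local instance : TopologicalSpace (Function.End Z) := Pi.topologicalSpace

local instance [T2Space Z] : T2Space (Function.End Z) := inferInstanceAs (T2Space (Z → Z))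

local instance [CompactSpace Z] : CompactSpace (Function.End Z) :=
  inferInstanceAs (CompactSpace (Z → Z))

theorem continuous_end_apply (z : Z) : Continuous fun p : Function.End Z => p z :=
  continuous_apply z

theorem continuous_end_mul_right (q : Function.End Z) :
    Continuous fun p : Function.End Z => p * q :=
  continuous_pi fun z => continuous_end_apply (q z)

/-- The Ellis (enveloping) semigroup of an action: the closure of the translations `z ↦ m • z` in
the semigroup of all self-maps, for the topology of pointwise convergence. -/
def ellisSemigroup (M Z : Type*) [Monoid M] [TopologicalSpace Z] [MulAction M Z] :
    Set (Function.End Z) :=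
  closure (Set.range (MulAction.toEndHom : M →* Function.End Z))

section Monoid

variable {M : Type*} [Monoid M] [MulAction M Z]

theorem isClosed_ellisSemigroup : IsClosed (ellisSemigroup M Z) := isClosed_closure

theorem mul_mem_ellisSemigroup [ContinuousConstSMul M Z] {p q : Function.End Z}
    (hp : p ∈ ellisSemigroup M Z) (hq : q ∈ ellisSemigroup M Z) : p * q ∈ ellisSemigroup M Z := by
  have translation_mul_mem (m : M) : MulAction.toEndHom m * q ∈ ellisSemigroup M Z := by
    refine map_mem_closure (f := fun q => MulAction.toEndHom m * q)
      (continuous_pi fun z => (continuous_end_apply z).const_smul m) hq ?_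
    rintro _ ⟨n, rfl⟩
    exact ⟨m * n, map_mul _ m n⟩
  exact closure_minimal (t := {p | p * q ∈ ellisSemigroup M Z})
    (Set.range_subset_iff.mpr translation_mul_mem)
    (isClosed_ellisSemigroup.preimage (continuous_end_mul_right q)) hp

theorem apply_mem_closure_orbit {p : Function.End Z} (hp : p ∈ ellisSemigroup M Z) (a : Z) :
    p a ∈ closure (MulAction.orbit M a) := by
  refine map_mem_closure (f := fun p : Function.End Z => p a) (continuous_end_apply a) hp ?_
  rintro _ ⟨m, rfl⟩
  exact MulAction.mem_orbit a m

theorem exists_ellisSemigroup_apply_eq [CompactSpace Z] [T2Space Z] {a b : Z}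
    (hb : b ∈ closure (MulAction.orbit M a)) : ∃ p ∈ ellisSemigroup M Z, p a = b := by
  have isClosed_image : IsClosed ((fun p : Function.End Z => p a) '' ellisSemigroup M Z) :=
    (isClosed_ellisSemigroup.isCompact.image (continuous_end_apply a)).isClosed
  refine closure_minimal (Set.range_subset_iff.mpr fun m => ?_) isClosed_image hb
  exact ⟨MulAction.toEndHom m, subset_closure ⟨m, rfl⟩, rfl⟩

end Monoid

theorem IsDistal.eq_of_proximal {G X : Type*} [Group G] [TopologicalSpace X] [MulAction G X]
    (h : IsDistal G X) {x y : X} (hxy : Proximal G x y) : x = y :=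
  (Set.ext_iff.mp h (x, y)).mp hxy

variable {M : Type*} [Group M] [MulAction M Z]

theorem IsDistal.apply_eq_self_of_isIdempotentElem (h : IsDistal M Z) {u : Function.End Z}
    (hu : u ∈ ellisSemigroup M Z) (huu : IsIdempotentElem u) (z : Z) : u z = z := by
  refine (h.eq_of_proximal fun U hU => ?_).symm
  have tendsto_pair : Filter.Tendsto (fun p : Function.End Z => (p z, p (u z))) (𝓝 u)
      (𝓝ˢ (Set.diagonal Z)) :=
    (((continuous_end_apply z).prodMk (continuous_end_apply (u z))).tendsto u).mono_right
      (nhds_le_nhdsSet (congrFun huu z).symm)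
  obtain ⟨_, hpU, m, rfl⟩ := mem_closure_iff_nhds.mp hu _ (tendsto_pair hU)
  exact ⟨m, hpU⟩

theorem IsDistal.mem_closure_orbit_symm [CompactSpace Z] [T2Space Z] [ContinuousConstSMul M Z]
    (h : IsDistal M Z) {a b : Z} (hb : b ∈ closure (MulAction.orbit M a)) :
    a ∈ closure (MulAction.orbit M b) := by
  obtain ⟨p, hp, rfl⟩ := exists_ellisSemigroup_apply_eq hb
  -- The left ideal `E p` of the Ellis semigroup `E` contains an idempotent `q p`.
  obtain ⟨_, ⟨q, hq, rfl⟩, hqp⟩ := exists_idempotent_in_compact_subsemigroup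
    continuous_end_mul_right ((· * p) '' ellisSemigroup M Z) (Set.Nonempty.image _ ⟨p, hp⟩)
    (isClosed_ellisSemigroup.isCompact.image (continuous_end_mul_right p)) (by
      rintro _ ⟨q, hq, rfl⟩ _ ⟨q', hq', rfl⟩
      exact ⟨q * p * q', mul_mem_ellisSemigroup (mul_mem_ellisSemigroup hq hp) hq',
        mul_assoc _ _ _⟩)
  have q_apply : q (p a) = a :=
    h.apply_eq_self_of_isIdempotentElem (mul_mem_ellisSemigroup hq hp) hqp a
  simpa only [q_apply] using apply_mem_closure_orbit hq (p a)

theorem Proximal.apply {ι G X : Type*} [Group G] [TopologicalSpace X] [MulAction G X]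
    {Γ : Subgroup (ι → G)} {c c' : ι → X} (h : Proximal Γ c c') (i : ι) :
    Proximal G (c i) (c' i) := by
  intro U hU
  have hcont : Continuous fun p : (ι → X) × (ι → X) => (p.1 i, p.2 i) := by fun_prop
  obtain ⟨γ, hγ⟩ := h _ (hcont.tendsto_nhdsSet (fun _ hp => congrFun hp i) hU)
  exact ⟨(γ : ι → G) i, hγ⟩

theorem IsDistal.pi {ι G X : Type*} [Group G] [TopologicalSpace X] [MulAction G X]
    (h : IsDistal G X) (Γ : Subgroup (ι → G)) : IsDistal Γ (ι → X) := by
  ext ⟨c, c'⟩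
  refine ⟨fun hc => funext fun i => h.eq_of_proximal (Proximal.apply hc i), ?_⟩
  rintro (rfl : c = c') U hU
  exact ⟨1, subset_of_mem_nhdsSet hU rfl⟩

end EllisSemigroup

section ApproximateContinuity

theorem exists_finset_cover_prod_self_subset {Y : Type*} [TopologicalSpace Y] [CompactSpace Y]
    {W : Set (Y × Y)} (hW : IsOpen W) (hdiag : Set.diagonal Y ⊆ W) :
    ∃ (O : Y → Set Y) (t : Finset Y),
      (∀ y, IsOpen (O y)) ∧ (∀ y, O y ×ˢ O y ⊆ W) ∧ ∀ b, ∃ y ∈ t, b ∈ O y := by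
  have exists_square (y : Y) : ∃ O, IsOpen O ∧ y ∈ O ∧ O ×ˢ O ⊆ W :=
    exists_nhds_square (hW.mem_nhds (hdiag rfl))
  choose O hO hyO hOW using exists_square
  obtain ⟨t, ht⟩ := isCompact_univ.elim_finite_subcover O hO fun y _ =>
    Set.mem_iUnion.mpr ⟨y, hyO y⟩
  exact ⟨O, t, hO, hOW, fun b => by simpa using ht (Set.mem_univ b)⟩

/-- Lower semicontinuity of the set-valued map `z ↦ closure {T i z | i}` yields a point of upper
semicontinuity up to the error `W`. -/
theorem exists_forall_mem_closure_graph {ι Y Z : Type*} [TopologicalSpace Y] [CompactSpace Y]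
    [TopologicalSpace Z] [Nonempty Z] {T : ι → Z → Y} (hT : ∀ i, Continuous (T i))
    {W : Set (Y × Y)} (hW : IsOpen W) (hdiag : Set.diagonal Y ⊆ W) :
    ∃ e, ∀ b, (e, b) ∈ closure {p : Z × Y | ∃ i, T i p.1 = p.2} → ∃ i, (b, T i e) ∈ W := by
  obtain ⟨O, t, hO, hOW, hcover⟩ := exists_finset_cover_prod_self_subset hW hdiag
  let V (y : Y) : Set Z := ⋃ i, T i ⁻¹' O y
  have isOpen_V (y : Y) : IsOpen (V y) := isOpen_iUnion fun i => (hO y).preimage (hT i)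
  have dense_compl_frontier (y : Y) : Dense (frontier (V y))ᶜ := by
    rw [← interior_eq_empty_iff_dense_compl, ← frontier_compl]
    exact interior_frontier (isOpen_V y).isClosed_compl
  obtain ⟨e, he⟩ : ∃ e, ∀ y ∈ t, e ∉ frontier (V y) := by
    simpa using ((t.finite_toSet.image fun y => (frontier (V y))ᶜ).dense_sInter
      (Set.forall_mem_image.mpr fun _ _ => isClosed_frontier.isOpen_compl)
      (Set.forall_mem_image.mpr fun y _ => dense_compl_frontier y)).nonempty
  refine ⟨e, fun b hb => ?_⟩
  obtain ⟨y, hyt, hby⟩ := hcover b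
  have mem_closure_V : e ∈ closure (V y) := by
    refine mem_closure_iff_nhds.mpr fun N hN => ?_
    obtain ⟨⟨z, _⟩, ⟨hzN, hzO⟩, i, (rfl : T i z = _)⟩ :=
      mem_closure_iff_nhds.mp hb _ (prod_mem_nhds hN ((hO y).mem_nhds hby))
    exact ⟨z, hzN, Set.mem_iUnion.mpr ⟨i, hzO⟩⟩
  have mem_V : e ∈ V y := by
    by_contra hn
    exact he y hyt ⟨mem_closure_V, by rwa [(isOpen_V y).interior_eq]⟩
  obtain ⟨i, hi⟩ := Set.mem_iUnion.mp mem_V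
  exact ⟨i, hOW y ⟨hby, hi⟩⟩

end ApproximateContinuity

section CubeGroups

variable {G : Type*} [Group G] {d : ℕ}

theorem faceElement_mem_faceGroup (g : G) (i : Fin d) :
    faceElement g (hyperface i 1) ∈ faceGroup G d :=
  Subgroup.subset_closure ⟨g, i, rfl⟩

theorem faceGroup_le_iff {K : Subgroup (Config d G)} :
    faceGroup G d ≤ K ↔ ∀ (g : G) (i : Fin d), faceElement g (hyperface i 1) ∈ K := by
  refine ⟨fun h g i => h (faceElement_mem_faceGroup g i), fun h => ?_⟩
  refine (Subgroup.closure_le K).mpr ?_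
  rintro _ ⟨g, i, rfl⟩
  exact h g i

theorem faceGroup_le_hostKraGroup : faceGroup G d ≤ hostKraGroup G d :=
  Subgroup.closure_mono fun _ ⟨g, i, h⟩ => ⟨g, i, 1, h⟩

theorem apply_zero_of_mem_faceGroup {f : Config d G} (hf : f ∈ faceGroup G d) : f 0 = 1 := by
  have faceGroup_le_ker : faceGroup G d ≤ (Pi.evalMonoidHom (fun _ : Cube d => G) 0).ker :=
    faceGroup_le_iff.mpr fun g i => by simp [MonoidHom.mem_ker, faceElement, hyperface]
  exact faceGroup_le_ker hf

theorem constConfig_conj_faceElement (g h : G) (F : Set (Cube d)) :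
    constConfig d g * faceElement h F * (constConfig d g)⁻¹ = faceElement (g * h * g⁻¹) F := by
  ext ω
  by_cases hω : ω ∈ F <;> simp [faceElement, constConfig, hω]

theorem constConfig_conj_mem_faceGroup (g : G) {f : Config d G} (hf : f ∈ faceGroup G d) :
    constConfig d g * f * (constConfig d g)⁻¹ ∈ faceGroup G d := by
  have faceGroup_le_comap_conj :
      faceGroup G d ≤ (faceGroup G d).comap (MulAut.conj (constConfig d g)).toMonoidHom :=
    faceGroup_le_iff.mpr fun h i => by
      simpa [constConfig_conj_faceElement] using faceElement_mem_faceGroup (g * h * g⁻¹) i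
  exact faceGroup_le_comap_conj hf

/-- The group generated by `F^[d]` and the diagonal of `G^[d]`. It is `HK^[d]` for `d ≥ 1`, whereas
for `d = 0` it is all of `G^[0]` and `HK^[0]` is trivial. -/
def diagFaceGroup (G : Type*) [Group G] (d : ℕ) : Subgroup (Config d G) :=
  faceGroup G d ⊔ (Pi.constMonoidHom (Cube d) G).range

theorem faceGroup_le_diagFaceGroup : faceGroup G d ≤ diagFaceGroup G d := le_sup_left

theorem constConfig_mem_diagFaceGroup (d : ℕ) (g : G) : constConfig d g ∈ diagFaceGroup G d :=
  Subgroup.mem_sup_right ⟨g, rfl⟩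

theorem exists_eq_mul_constConfig_of_mem_diagFaceGroup {γ : Config d G}
    (hγ : γ ∈ diagFaceGroup G d) : ∃ f ∈ faceGroup G d, ∃ g : G, f * constConfig d g = γ := by
  have diagonal_le_normalizer :
      (Pi.constMonoidHom (Cube d) G).range ≤ Subgroup.normalizer (faceGroup G d) := by
    refine Subgroup.le_normalizer_iff.mpr ?_
    rintro _ ⟨g, rfl⟩ f hf
    exact constConfig_conj_mem_faceGroup g hf
  rw [diagFaceGroup, ← SetLike.mem_coe,
    Subgroup.coe_mul_of_right_le_normalizer_left _ _ diagonal_le_normalizer] at hγ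
  obtain ⟨f, hf, _, ⟨g, rfl⟩, rfl⟩ := hγ
  exact ⟨f, hf, g, rfl⟩

theorem faceElement_lower_hyperface (g : G) (i : Fin d) :
    faceElement g (hyperface i 0) = faceElement g⁻¹ (hyperface i 1) * constConfig d g := by
  ext ω
  obtain hω | hω : ω i = 0 ∨ ω i = 1 := by omega
  all_goals simp [faceElement, hyperface, constConfig, hω]

theorem hostKraGroup_le_diagFaceGroup : hostKraGroup G d ≤ diagFaceGroup G d := by
  refine (Subgroup.closure_le _).mpr ?_
  rintro _ ⟨g, i, a, rfl⟩
  obtain rfl | rfl : a = 0 ∨ a = 1 := by omega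
  · rw [faceElement_lower_hyperface]
    exact mul_mem (faceGroup_le_diagFaceGroup (faceElement_mem_faceGroup g⁻¹ i))
      (constConfig_mem_diagFaceGroup d g)
  · exact faceGroup_le_diagFaceGroup (faceElement_mem_faceGroup g i)

end CubeGroups

section Splitting

variable {G X : Type*} {d : ℕ}

/-- The restriction of a configuration to the face `{ω | ω 0 = a}`, as a configuration on the cube
of the remaining coordinates. -/
def faceRestrict (a : Fin 2) (c : Config (d + 1) X) : Config d X := fun ω => c (Fin.cons a ω)

/-- The configuration with prescribed restrictions to the faces `{ω | ω 0 = 0}` and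
`{ω | ω 0 = 1}`. -/
def join (a b : Config d X) : Config (d + 1) X := fun ω => ![a, b] (ω 0) (Fin.tail ω)

theorem eq_of_faceRestrict_eq {c c' : Config (d + 1) X}
    (h₀ : faceRestrict 0 c = faceRestrict 0 c') (h₁ : faceRestrict 1 c = faceRestrict 1 c') :
    c = c' := by
  ext ω
  rw [← Fin.cons_self_tail ω]
  obtain hω | hω : ω 0 = 0 ∨ ω 0 = 1 := by omega
  · rw [hω]
    exact congrFun h₀ _
  · rw [hω]
    exact congrFun h₁ _

theorem join_faceRestrict (c : Config (d + 1) X) :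
    join (faceRestrict 0 c) (faceRestrict 1 c) = c :=
  eq_of_faceRestrict_eq rfl rfl

theorem faceRestrict_zero_apply_zero (c : Config (d + 1) X) : faceRestrict 0 c 0 = c 0 :=
  congrArg c Matrix.cons_zero_zero

variable [Group G]

/-- `join` as a homomorphism of groups of configurations. -/
def joinHom (G : Type*) [Group G] (d : ℕ) : Config d G × Config d G →* Config (d + 1) G where
  toFun p := join p.1 p.2
  map_one' := eq_of_faceRestrict_eq rfl rfl
  map_mul' _ _ := eq_of_faceRestrict_eq rfl rfl

/-- `faceRestrict` as a homomorphism of groups of configurations. -/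
def faceRestrictHom (G : Type*) [Group G] (d : ℕ) (a : Fin 2) :
    Config (d + 1) G →* Config d G where
  toFun := faceRestrict a
  map_one' := rfl
  map_mul' _ _ := rfl

theorem faceRestrict_zero_faceElement_zero (g : G) :
    faceRestrict 0 (faceElement g (hyperface (0 : Fin (d + 1)) 1)) = 1 := by
  ext ω
  simp [faceRestrict, faceElement, hyperface]

theorem faceRestrict_one_faceElement_zero (g : G) :
    faceRestrict 1 (faceElement g (hyperface (0 : Fin (d + 1)) 1)) = constConfig d g := by
  ext ω
  simp [faceRestrict, faceElement, hyperface, constConfig]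

theorem join_self_mem_faceGroup {f : Config d G} (hf : f ∈ faceGroup G d) :
    join f f ∈ faceGroup G (d + 1) := by
  have faceGroup_le_comap : faceGroup G d ≤ (faceGroup G (d + 1)).comap
      ((joinHom G d).comp ((MonoidHom.id _).prod (MonoidHom.id _))) := by
    refine faceGroup_le_iff.mpr fun g i => ?_
    have join_faceElement : join (faceElement g (hyperface i 1)) (faceElement g (hyperface i 1)) =
        faceElement g (hyperface i.succ 1) := eq_of_faceRestrict_eq rfl rfl
    change join (faceElement g _) (faceElement g _) ∈ faceGroup G (d + 1)
    rw [join_faceElement]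
    exact faceElement_mem_faceGroup g i.succ
  exact faceGroup_le_comap hf

theorem faceRestrict_zero_mem_faceGroup {γ : Config (d + 1) G} (hγ : γ ∈ faceGroup G (d + 1)) :
    faceRestrict 0 γ ∈ faceGroup G d := by
  have faceGroup_le_comap :
      faceGroup G (d + 1) ≤ (faceGroup G d).comap (faceRestrictHom G d 0) := by
    refine faceGroup_le_iff.mpr fun g => Fin.cases ?_ (faceElement_mem_faceGroup g)
    change faceRestrict 0 (faceElement g _) ∈ faceGroup G d
    rw [faceRestrict_zero_faceElement_zero]
    exact one_mem _
  exact faceGroup_le_comap hγ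

theorem faceRestrict_one_mem_diagFaceGroup {γ : Config (d + 1) G}
    (hγ : γ ∈ faceGroup G (d + 1)) : faceRestrict 1 γ ∈ diagFaceGroup G d := by
  have faceGroup_le_comap :
      faceGroup G (d + 1) ≤ (diagFaceGroup G d).comap (faceRestrictHom G d 1) := by
    refine faceGroup_le_iff.mpr fun g => Fin.cases ?_ fun i =>
      faceGroup_le_diagFaceGroup (faceElement_mem_faceGroup g i)
    change faceRestrict 1 (faceElement g _) ∈ diagFaceGroup G d
    rw [faceRestrict_one_faceElement_zero]
    exact constConfig_mem_diagFaceGroup d g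
  exact faceGroup_le_comap hγ

/-- The group of all `n ∈ G^[d]` such that `(1, n)` is in the face group `F^[d+1]`. -/
def upperGroup (G : Type*) [Group G] (d : ℕ) : Subgroup (Config d G) :=
  (faceGroup G (d + 1)).comap ((joinHom G d).comp (MonoidHom.inr _ _))

theorem mem_upperGroup {n : Config d G} : n ∈ upperGroup G d ↔ join 1 n ∈ faceGroup G (d + 1) :=
  Iff.rfl

theorem constConfig_mem_upperGroup (g : G) : constConfig d g ∈ upperGroup G d := by
  have join_one_constConfig :
      join 1 (constConfig d g) = faceElement g (hyperface (0 : Fin (d + 1)) 1) :=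
    eq_of_faceRestrict_eq (faceRestrict_zero_faceElement_zero g).symm
      (faceRestrict_one_faceElement_zero g).symm
  rw [mem_upperGroup, join_one_constConfig]
  exact faceElement_mem_faceGroup g 0

theorem upperGroup_le_diagFaceGroup : upperGroup G d ≤ diagFaceGroup G d :=
  fun _ hn => faceRestrict_one_mem_diagFaceGroup (mem_upperGroup.mp hn)

theorem exists_eq_join_of_mem_faceGroup {γ : Config (d + 1) G} (hγ : γ ∈ faceGroup G (d + 1)) :
    ∃ f ∈ faceGroup G d, ∃ n ∈ upperGroup G d, γ = join f (n * f) := by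
  let f := faceRestrict 0 γ
  have hf : f ∈ faceGroup G d := faceRestrict_zero_mem_faceGroup hγ
  refine ⟨f, hf, faceRestrict 1 γ * f⁻¹, ?_, ?_⟩
  · have join_one : join 1 (faceRestrict 1 γ * f⁻¹) = γ * (join f f)⁻¹ :=
      eq_of_faceRestrict_eq (mul_inv_cancel f).symm rfl
    rw [mem_upperGroup, join_one]
    exact mul_mem hγ (inv_mem (join_self_mem_faceGroup hf))
  · rw [inv_mul_cancel_right, join_faceRestrict]

theorem join_one_right_mem_diagFaceGroup {n : Config d G} (hn : n ∈ upperGroup G d) :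
    join n 1 ∈ diagFaceGroup G (d + 1) := by
  obtain ⟨f, hf, g, rfl⟩ :=
    exists_eq_mul_constConfig_of_mem_diagFaceGroup (upperGroup_le_diagFaceGroup hn)
  set n := f * constConfig d g
  have join_eq : join n 1 = join f f * constConfig (d + 1) g * (join 1 n)⁻¹ :=
    eq_of_faceRestrict_eq (by simp : n = n * 1⁻¹) (mul_inv_cancel n).symm
  rw [join_eq]
  exact mul_mem (mul_mem (faceGroup_le_diagFaceGroup (join_self_mem_faceGroup hf))
    (constConfig_mem_diagFaceGroup _ g)) (inv_mem (faceGroup_le_diagFaceGroup hn))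

end Splitting

section DynamicalCubes

variable {G X : Type*} [Group G] [TopologicalSpace X] [MulAction G X] {d : ℕ}

theorem continuous_join : Continuous fun p : Config d X × Config d X => join p.1 p.2 := by
  refine continuous_pi fun ω => ?_
  obtain hω | hω : ω 0 = 0 ∨ ω 0 = 1 := by omega
  all_goals
    simp only [join, hω, Matrix.cons_val_zero, Matrix.cons_val_one]
    fun_prop

theorem continuous_faceRestrict (a : Fin 2) :
    Continuous (faceRestrict a : Config (d + 1) X → Config d X) :=
  continuous_pi fun _ => continuous_apply _

theorem dynCubes_eq_closure_iUnion_orbit_faceGroup :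
    dynCubes G X d = closure (⋃ x : X, MulAction.orbit (faceGroup G d) (constConfig d x)) := by
  refine congrArg closure (Set.Subset.antisymm ?_ ?_)
  · refine Set.iUnion_subset fun x => ?_
    rintro _ ⟨⟨γ, hγ⟩, rfl⟩
    obtain ⟨f, hf, g, rfl⟩ :=
      exists_eq_mul_constConfig_of_mem_diagFaceGroup (hostKraGroup_le_diagFaceGroup hγ)
    exact Set.mem_iUnion.mpr ⟨g • x, ⟨f, hf⟩, (mul_smul f (constConfig d g) (constConfig d x)).symm⟩
  · refine Set.iUnion_mono fun x => ?_
    rintro _ ⟨⟨f, hf⟩, rfl⟩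
    exact ⟨⟨f, faceGroup_le_hostKraGroup hf⟩, rfl⟩

theorem isClosed_dynCubes : IsClosed (dynCubes G X d) := isClosed_closure

theorem constConfig_mem_dynCubes (d : ℕ) (x : X) : constConfig d x ∈ dynCubes G X d :=
  subset_closure (Set.mem_iUnion.mpr ⟨x, MulAction.mem_orbit_self _⟩)

theorem faceRestrict_zero_mem_dynCubes {c : Config (d + 1) X} (hc : c ∈ dynCubes G X (d + 1)) :
    faceRestrict 0 c ∈ dynCubes G X d := by
  rw [dynCubes_eq_closure_iUnion_orbit_faceGroup] at hc ⊢
  refine map_mem_closure (continuous_faceRestrict 0) hc fun c hc => ?_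
  obtain ⟨x, ⟨γ, hγ⟩, rfl⟩ := Set.mem_iUnion.mp hc
  exact Set.mem_iUnion.mpr ⟨x, ⟨_, faceRestrict_zero_mem_faceGroup hγ⟩, rfl⟩

theorem join_self_mem_faceOrbitClosure {x : X} {e : Config d X}
    (he : e ∈ faceOrbitClosure G d x) : join e e ∈ faceOrbitClosure G (d + 1) x := by
  refine map_mem_closure (f := fun e : Config d X => join e e)
    (continuous_join.comp (continuous_id.prodMk continuous_id)) he ?_
  rintro _ ⟨⟨f, hf⟩, rfl⟩
  refine ⟨⟨join f f, join_self_mem_faceGroup hf⟩, ?_⟩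
  exact eq_of_faceRestrict_eq rfl rfl

theorem exists_join_mem_closure_orbit [CompactSpace X] [T2Space X] {c : Config (d + 1) X}
    {e : Config d X} (he : e ∈ closure (MulAction.orbit (faceGroup G d) (faceRestrict 0 c))) :
    ∃ b, join e b ∈ closure (MulAction.orbit (faceGroup G (d + 1)) c) := by
  have isClosed_image :
      IsClosed (faceRestrict 0 '' closure (MulAction.orbit (faceGroup G (d + 1)) c)) :=
    (isClosed_closure.isCompact.image (continuous_faceRestrict 0)).isClosed
  have orbit_subset_image : MulAction.orbit (faceGroup G d) (faceRestrict 0 c) ⊆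
      faceRestrict 0 '' closure (MulAction.orbit (faceGroup G (d + 1)) c) := by
    rintro _ ⟨⟨f, hf⟩, rfl⟩
    exact ⟨join f f • c, subset_closure ⟨⟨_, join_self_mem_faceGroup hf⟩, rfl⟩, rfl⟩
  obtain ⟨z, hz, rfl⟩ := closure_minimal orbit_subset_image isClosed_image he
  exact ⟨faceRestrict 1 z, by rwa [join_faceRestrict]⟩

theorem exists_isOpen_diagonal_of_disjoint [CompactSpace X] [T2Space X]
    {A B : Set (Config (d + 1) X)} (hA : IsClosed A) (hB : IsClosed B) (hAB : Disjoint A B) :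
    ∃ W : Set (Config d X × Config d X), IsOpen W ∧ Set.diagonal (Config d X) ⊆ W ∧
      ∀ e b b', join e b ∈ A → join e b' ∈ B → (b, b') ∉ W := by
  let P : Set (Config (d + 1) X × Config (d + 1) X) :=
    A ×ˢ B ∩ {p | faceRestrict 0 p.1 = faceRestrict 0 p.2}
  let π : Config (d + 1) X × Config (d + 1) X → Config d X × Config d X :=
    Prod.map (faceRestrict 1) (faceRestrict 1)
  have isClosed_P : IsClosed P := (hA.prod hB).inter <|
    isClosed_eq ((continuous_faceRestrict 0).comp continuous_fst)
      ((continuous_faceRestrict 0).comp continuous_snd)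
  have isClosed_image : IsClosed (π '' P) := (isClosed_P.isCompact.image
    ((continuous_faceRestrict 1).prodMap (continuous_faceRestrict 1))).isClosed
  refine ⟨(π '' P)ᶜ, isClosed_image.isOpen_compl, ?_, ?_⟩
  · rintro ⟨b, _⟩ (rfl : b = _) ⟨⟨c, c'⟩, ⟨⟨hc, hc'⟩, h₀⟩, hπ⟩
    have h₁ : faceRestrict 1 c = faceRestrict 1 c' :=
      (congrArg Prod.fst hπ).trans (congrArg Prod.snd hπ).symm
    exact hAB.ne_of_mem hc hc' (eq_of_faceRestrict_eq h₀ h₁)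
  · exact fun e b b' hb hb' hW => hW ⟨(join e b, join e b'), ⟨⟨hb, hb'⟩, rfl⟩, rfl⟩

variable [ContinuousConstSMul G X]

theorem smul_mem_dynCubes {γ : Config d G} (hγ : γ ∈ diagFaceGroup G d) {c : Config d X}
    (hc : c ∈ dynCubes G X d) : γ • c ∈ dynCubes G X d := by
  rw [dynCubes_eq_closure_iUnion_orbit_faceGroup] at hc ⊢
  refine map_mem_closure (continuous_const_smul γ) hc fun c hc => ?_
  obtain ⟨x, ⟨f, hf⟩, rfl⟩ := Set.mem_iUnion.mp hc
  obtain ⟨f', hf', g, hfg⟩ := exists_eq_mul_constConfig_of_mem_diagFaceGroup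
    (mul_mem hγ (faceGroup_le_diagFaceGroup hf))
  refine Set.mem_iUnion.mpr ⟨g • x, ⟨f', hf'⟩, ?_⟩
  calc f' • constConfig d g • constConfig d x = (γ * f) • constConfig d x := by
        rw [← hfg, mul_smul]
    _ = γ • f • constConfig d x := mul_smul γ f _

theorem join_smul_mem_faceOrbitClosure {x : X} {e : Config d X} {n : Config d G}
    (hn : n ∈ upperGroup G d) (he : e ∈ faceOrbitClosure G d x) :
    join e (n • e) ∈ faceOrbitClosure G (d + 1) x := by
  have join_smul_eq : join e (n • e) = (⟨join 1 n, hn⟩ : faceGroup G (d + 1)) • join e e :=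
    eq_of_faceRestrict_eq (one_smul (Config d G) e).symm rfl
  rw [join_smul_eq]
  exact smul_mem_closure_orbit _ (join_self_mem_faceOrbitClosure he)

theorem closure_orbit_subset_dynCubes {Γ : Subgroup (Config d G)} (hΓ : Γ ≤ diagFaceGroup G d)
    {c : Config d X} (hc : c ∈ dynCubes G X d) : closure (MulAction.orbit Γ c) ⊆ dynCubes G X d :=
  closure_orbit_subset isClosed_dynCubes (fun γ _ => smul_mem_dynCubes (hΓ γ.2)) hc

theorem faceOrbitClosure_subset_cubesAt [T2Space X] (d : ℕ) (x : X) :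
    faceOrbitClosure G d x ⊆ cubesAt G d x := by
  refine Set.subset_inter (closure_orbit_subset_dynCubes faceGroup_le_diagFaceGroup
    (constConfig_mem_dynCubes d x)) (closure_minimal ?_
      (isClosed_eq (continuous_apply 0) continuous_const))
  rintro _ ⟨⟨f, hf⟩, rfl⟩
  change f 0 • x = x
  rw [apply_zero_of_mem_faceGroup hf, one_smul]

end DynamicalCubes

section RegularCubes

variable {G X : Type*} [Group G] [TopologicalSpace X] [MulAction G X] {d : ℕ}

/-- A cube `e` is regular up to the error `W` if every upper face `b` completing the lower face `e`
to a dynamical cube is `W`-close to the orbit of `e` under the group of upper faces. -/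
def IsRegularCube (G : Type*) {X : Type*} [Group G] [TopologicalSpace X] [MulAction G X] {d : ℕ}
    (W : Set (Config d X × Config d X)) (e : Config d X) : Prop :=
  e ∈ dynCubes G X d ∧
    ∀ b, join e b ∈ dynCubes G X (d + 1) → ∃ n ∈ upperGroup G d, (b, n • e) ∈ W

theorem exists_apply_zero_eq_mem_closure_orbit_upperGroup [CompactSpace X] [T2Space X]
    [MulAction.IsMinimal G X] (x : X) (e : Config d X) :
    ∃ e' ∈ closure (MulAction.orbit (upperGroup G d) e), e' 0 = x := by
  have isClosed_image :
      IsClosed ((fun c : Config d X => c 0) '' closure (MulAction.orbit (upperGroup G d) e)) :=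
    (isClosed_closure.isCompact.image (continuous_apply 0)).isClosed
  refine closure_minimal ?_ isClosed_image (MulAction.dense_orbit G (e 0) x)
  rintro _ ⟨g, rfl⟩
  exact ⟨constConfig d g • e, subset_closure ⟨⟨_, constConfig_mem_upperGroup g⟩, rfl⟩, rfl⟩

variable [ContinuousConstSMul G X]

theorem mem_closure_graph_of_join_mem_dynCubes (e : dynCubes G X d) {b : Config d X}
    (h : join e b ∈ dynCubes G X (d + 1)) :
    (e, b) ∈ closure {p : dynCubes G X d × Config d X |
      ∃ n : upperGroup G d, n • (p.1 : Config d X) = p.2} := by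
  have isInducing_coe : IsInducing
      (Prod.map Subtype.val id : dynCubes G X d × Config d X → Config d X × Config d X) :=
    IsInducing.subtypeVal.prodMap .id
  rw [isInducing_coe.closure_eq_preimage_closure_image]
  rw [dynCubes_eq_closure_iUnion_orbit_faceGroup] at h
  refine map_mem_closure (f := fun c => (faceRestrict 0 c, faceRestrict 1 c))
    ((continuous_faceRestrict 0).prodMk (continuous_faceRestrict 1)) h fun c hc => ?_
  obtain ⟨x, ⟨γ, hγ⟩, rfl⟩ := Set.mem_iUnion.mp hc
  obtain ⟨f, hf, n, hn, rfl⟩ := exists_eq_join_of_mem_faceGroup hγ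
  have mem_dynCubes : f • constConfig d x ∈ dynCubes G X d :=
    smul_mem_dynCubes (faceGroup_le_diagFaceGroup hf) (constConfig_mem_dynCubes d x)
  exact ⟨(⟨_, mem_dynCubes⟩, n • f • constConfig d x), ⟨⟨n, hn⟩, rfl⟩,
    Prod.ext rfl (mul_smul n f _).symm⟩

variable [CompactSpace X] {W : Set (Config d X × Config d X)}

theorem exists_isRegularCube [Nonempty X] (hW : IsOpen W)
    (hdiag : Set.diagonal (Config d X) ⊆ W) : ∃ e, IsRegularCube G W e := by
  have : Nonempty (dynCubes G X d) :=
    ‹Nonempty X›.map fun x => ⟨constConfig d x, constConfig_mem_dynCubes d x⟩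
  obtain ⟨e, he⟩ := exists_forall_mem_closure_graph
    (T := fun (n : upperGroup G d) (e : dynCubes G X d) => n • (e : Config d X))
    (fun n => continuous_subtype_val.const_smul n) hW hdiag
  refine ⟨e, e.2, fun b hb => ?_⟩
  obtain ⟨n, hn⟩ := he b (mem_closure_graph_of_join_mem_dynCubes e hb)
  exact ⟨n, n.2, hn⟩

variable [T2Space X]

theorem IsRegularCube.of_mem_closure_orbit (hdistal : IsDistal G X) (hW : IsOpen W)
    {e e' : Config d X} (he : IsRegularCube G W e)
    (he' : e' ∈ closure (MulAction.orbit (upperGroup G d) e)) : IsRegularCube G W e' := by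
  have e_mem_closure_orbit : e ∈ closure (MulAction.orbit (upperGroup G d) e') :=
    (hdistal.pi _).mem_closure_orbit_symm he'
  refine ⟨closure_orbit_subset_dynCubes upperGroup_le_diagFaceGroup he.1 he', fun b hb => ?_⟩
  have join_mem_dynCubes : join e b ∈ dynCubes G X (d + 1) := by
    refine closure_orbit_subset (S := {z | join z b ∈ dynCubes G X (d + 1)})
      (isClosed_dynCubes.preimage (continuous_join.comp (continuous_id.prodMk continuous_const)))
      (fun n z hz => ?_) hb e_mem_closure_orbit
    have join_smul_eq : join (n • z) b = join (n : Config d G) 1 • join z b :=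
      eq_of_faceRestrict_eq rfl (one_smul (Config d G) b).symm
    rw [Set.mem_ofPred_eq, join_smul_eq]
    exact smul_mem_dynCubes (join_one_right_mem_diagFaceGroup n.2) hz
  obtain ⟨n, hn, hbW⟩ := he.2 b join_mem_dynCubes
  obtain ⟨_, hnW, m, rfl⟩ := mem_closure_iff.mp e_mem_closure_orbit {z | (b, n • z) ∈ W}
    (hW.preimage (continuous_const.prodMk (continuous_const_smul n))) hbW
  exact ⟨n * m, mul_mem hn m.2, by rwa [mul_smul]⟩

theorem exists_isRegularCube_apply_zero_eq [MulAction.IsMinimal G X] (hdistal : IsDistal G X)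
    (hW : IsOpen W) (hdiag : Set.diagonal (Config d X) ⊆ W) (x : X) :
    ∃ e, IsRegularCube G W e ∧ e 0 = x := by
  have : Nonempty X := ⟨x⟩
  obtain ⟨e₀, he₀⟩ := exists_isRegularCube (G := G) hW hdiag
  obtain ⟨e, he, hex⟩ := exists_apply_zero_eq_mem_closure_orbit_upperGroup (G := G) x e₀
  exact ⟨e, he₀.of_mem_closure_orbit hdistal hW he, hex⟩

theorem cubesAt_succ_subset_faceOrbitClosure [MulAction.IsMinimal G X] (hdistal : IsDistal G X)
    {x : X} (ih : cubesAt G d x ⊆ faceOrbitClosure G d x) :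
    cubesAt G (d + 1) x ⊆ faceOrbitClosure G (d + 1) x := by
  rintro c ⟨hc, hcx⟩
  by_contra c_notMem
  have disjoint_orbitClosures : Disjoint (closure (MulAction.orbit (faceGroup G (d + 1)) c))
      (faceOrbitClosure G (d + 1) x) :=
    Set.disjoint_left.mpr fun z hzc hzx => c_notMem <|
      mem_closure_orbit_trans ((hdistal.pi _).mem_closure_orbit_symm hzc) hzx
  obtain ⟨W, hW, hdiag, separated⟩ :=
    exists_isOpen_diagonal_of_disjoint isClosed_closure isClosed_closure disjoint_orbitClosures
  obtain ⟨e, ⟨he, e_regular⟩, hex⟩ :=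
    exists_isRegularCube_apply_zero_eq (G := G) hdistal hW hdiag x
  have e_mem : e ∈ faceOrbitClosure G d x := ih ⟨he, hex⟩
  have lower_mem : faceRestrict 0 c ∈ faceOrbitClosure G d x :=
    ih ⟨faceRestrict_zero_mem_dynCubes hc, (faceRestrict_zero_apply_zero c).trans hcx⟩
  have e_mem_closure_orbit : e ∈ closure (MulAction.orbit (faceGroup G d) (faceRestrict 0 c)) :=
    mem_closure_orbit_trans e_mem ((hdistal.pi _).mem_closure_orbit_symm lower_mem)
  obtain ⟨b, hb⟩ := exists_join_mem_closure_orbit e_mem_closure_orbit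
  obtain ⟨n, hn, hbn⟩ :=
    e_regular b (closure_orbit_subset_dynCubes faceGroup_le_diagFaceGroup hc hb)
  exact separated e b (n • e) hb (join_smul_mem_faceOrbitClosure hn e_mem) hbn

theorem cubesAt_subset_faceOrbitClosure [MulAction.IsMinimal G X] (hdistal : IsDistal G X)
    (d : ℕ) (x : X) : cubesAt G d x ⊆ faceOrbitClosure G d x := by
  induction d with
  | zero =>
    rintro c ⟨-, rfl⟩
    have c_eq_const : constConfig 0 (c 0) = c := funext fun ω => congrArg c (Subsingleton.elim 0 ω)
    rw [← c_eq_const]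
    exact subset_closure (MulAction.mem_orbit_self _)
  | succ d ih => exact cubesAt_succ_subset_faceOrbitClosure hdistal ih

end RegularCubes

end CubeDynamics

theorem mainTheorem10_general {G : Type*} [Group G]
    {X : Type*} [TopologicalSpace X] [CompactSpace X] [T2Space X]
    [MulAction G X] [ContinuousConstSMul G X] [MulAction.IsMinimal G X]
    (hdistal : CubeDynamics.IsDistal G X) (d : ℕ) (x : X) :
    CubeDynamics.faceOrbitClosure G d x = CubeDynamics.cubesAt G d x ∧
      CubeDynamics.puncturedFaceOrbitClosure G d x = CubeDynamics.puncturedCubesAt G d x := by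
  have orbitClosure_eq_cubes : CubeDynamics.faceOrbitClosure G d x = CubeDynamics.cubesAt G d x :=
    (CubeDynamics.faceOrbitClosure_subset_cubesAt d x).antisymm
      (CubeDynamics.cubesAt_subset_faceOrbitClosure hdistal d x)
  exact ⟨orbitClosure_eq_cubes, congrArg (CubeDynamics.forgetZero '' ·) orbitClosure_eq_cubes⟩

theorem mainTheorem10 {G : Type*} [Group G] [TopologicalSpace G] [IsTopologicalGroup G] [T2Space G]
    {X : Type*} [TopologicalSpace X] [CompactSpace X] [T2Space X]
    [MulAction G X] [ContinuousSMul G X]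
    (hmin : MulAction.IsMinimal G X) (hdistal : CubeDynamics.IsDistal G X)
    (d : ℕ) (hd : 1 ≤ d) (x : X) :
    CubeDynamics.faceOrbitClosure G d x = CubeDynamics.cubesAt G d x ∧
      CubeDynamics.puncturedFaceOrbitClosure G d x = CubeDynamics.puncturedCubesAt G d x := by
  exact mainTheorem10_general hdistal d x
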